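/- Conventions. A unital Kreĭn C*-algebra is a unital complex $*$-algebra $\mathcal A$ (no norm is fixed) that admits at least one fundamental symmetry. A fundamental symmetry of $\mathcal A$ is a $*$-automorphism $\alpha:\mathcal A\to\mathcal A$ with $\alpha\circ\alpha=\mathrm{id}$ for which there is a complete submultiplicative norm $\|\cdot\|$ on $\mathcal A$ with $\|\alpha(x^*)x\|=\|x\|^2$ for all $x\in\mathcal A$. A Kreĭn space is a complex vector space $K$ with a Hermitian sesquilinear form $\langle\cdot,\cdot\rangle$ that admits a fundamental decomposition, i.e. a direct sum decomposition $K=K_+\oplus K_-$ into orthogonal subspaces such that $K_+$ with $\langle\cdot,\cdot\rangle$ and $K_-$ with $-\langle\cdot,\cdot\rangle$ are Hilbert spaces. The fundamental symmetry of $K$ associated with this decomposition is $J:x_++x_-\mapsto x_+-x_-$, and $(x,y)\mapsto\langle x,Jy\rangle$ makes $K$ a Hilbert space, whose norm topology on $K$ does not depend on the decomposition. $B(K)$ is the algebra of linear operators on $K$ that are continuous for this topology, with the operator norm topology and with involution the Kreĭn adjoint, $\langle T^*x,y\rangle=\langle x,Ty\rangle$ for all $x,y\in K$. Theorem. Every unital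 Kreĭn C*-algebra $\mathcal A$ admits at least one faithful representation on a Kreĭn space, that is, an injective unital $*$-homomorphism $\pi:\mathcal A\to B(K)$ for some Kreĭn space $K$. More precisely, for every fundamental symmetry $\alpha$ of $\mathcal A$ there are a Kreĭn space $K$, a fundamental symmetry $J$ of $K$ and a faithful unital representation $\pi:\mathcal A\to B(K)$ such that $\pi$ is a $*$-isomorphism of $\mathcal A$ onto a closed unital $*$-subalgebra of $B(K)$ and $\pi(\alpha(x))=J\,\pi(x)\,J$ for all $x\in\mathcal A$. -/

import Mathlib

open scoped ComplexConjugate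

universe u

noncomputable section

/-! ### Krein spaces -/

/-- The sesquilinear form `B` (conjugate-linear in the first, linear in the second variable) is a
positive definite Hermitian inner product for which `V` is a Hilbert space. -/
def IsHilbertForm {V : Type*} [AddCommGroup V] [Module ℂ V] (B : V →ₗ⋆[ℂ] V →ₗ[ℂ] ℂ) : Prop :=
  ∃ c : InnerProductSpace.Core ℂ V, (∀ x y, c.inner x y = B x y) ∧
    @CompleteSpace V c.toNormedAddCommGroup.toMetricSpace.toUniformSpace

/-- A fundamental decomposition `K = K₊ ⊕ K₋` of a complex vector space with a form `B`: the
summands are `B`-orthogonal, `K₊` is a Hilbert space for `B` and `K₋` is one for `-B`. -/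
structure FundamentalDecomposition {K : Type*} [AddCommGroup K] [Module ℂ K]
    (B : K →ₗ⋆[ℂ] K →ₗ[ℂ] ℂ) where
  pos : Submodule ℂ K
  neg : Submodule ℂ K
  isCompl : IsCompl pos neg
  orthogonal : ∀ x ∈ pos, ∀ y ∈ neg, B x y = 0 ∧ B y x = 0
  pos_hilbert : IsHilbertForm (B.domRestrict₁₂ pos pos)
  neg_hilbert : IsHilbertForm ((-B).domRestrict₁₂ neg neg)

namespace FundamentalDecomposition

variable {K : Type*} [AddCommGroup K] [Module ℂ K] {B : K →ₗ⋆[ℂ] K →ₗ[ℂ] ℂ}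

/-- The projection `x₊ + x₋ ↦ x₊`. -/
def projPos (D : FundamentalDecomposition B) : K →ₗ[ℂ] K := D.pos.projection D.neg D.isCompl

/-- The projection `x₊ + x₋ ↦ x₋`. -/
def projNeg (D : FundamentalDecomposition B) : K →ₗ[ℂ] K :=
  D.neg.projection D.pos D.isCompl.symm

/-- The fundamental symmetry `J : x₊ + x₋ ↦ x₊ - x₋` as a linear map. -/
def symmetryₗ (D : FundamentalDecomposition B) : K →ₗ[ℂ] K := D.projPos - D.projNeg

variable (D : FundamentalDecomposition B)

theorem projPos_mem (x : K) : D.projPos x ∈ D.pos :=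
  Submodule.projection_apply_mem D.isCompl x

theorem projNeg_mem (x : K) : D.projNeg x ∈ D.neg :=
  Submodule.projection_apply_mem D.isCompl.symm x

theorem projPos_add_projNeg (x : K) : D.projPos x + D.projNeg x = x :=
  Submodule.projection_add_projection_eq_self D.isCompl x

theorem symmetryₗ_apply (x : K) : D.symmetryₗ x = D.projPos x - D.projNeg x := rfl

theorem projPos_of_pos {x : K} (hx : x ∈ D.pos) : D.projPos x = x :=
  Submodule.projection_apply_of_mem_left D.isCompl hx

theorem projNeg_of_neg {x : K} (hx : x ∈ D.neg) : D.projNeg x = x :=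
  Submodule.projection_apply_of_mem_left D.isCompl.symm hx

theorem projPos_of_neg {x : K} (hx : x ∈ D.neg) : D.projPos x = 0 :=
  (Submodule.projection_apply_eq_zero_iff D.isCompl).2 hx

theorem projNeg_of_pos {x : K} (hx : x ∈ D.pos) : D.projNeg x = 0 :=
  (Submodule.projection_apply_eq_zero_iff D.isCompl.symm).2 hx

theorem symmetryₗ_symmetryₗ (x : K) : D.symmetryₗ (D.symmetryₗ x) = x := by
  have h := D.projPos_add_projNeg x
  simp only [symmetryₗ_apply, map_sub, D.projPos_of_pos (D.projPos_mem x),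
    D.projNeg_of_neg (D.projNeg_mem x), D.projPos_of_neg (D.projNeg_mem x),
    D.projNeg_of_pos (D.projPos_mem x), sub_zero, zero_sub, sub_neg_eq_add]
  exact h

theorem form_symmetryₗ (x y : K) :
    B x (D.symmetryₗ y) = B (D.projPos x) (D.projPos y) - B (D.projNeg x) (D.projNeg y) := by
  conv_lhs => rw [← D.projPos_add_projNeg x]
  simp [symmetryₗ_apply, (D.orthogonal _ (D.projPos_mem x) _ (D.projNeg_mem y)).1,
    (D.orthogonal _ (D.projPos_mem y) _ (D.projNeg_mem x)).2, sub_eq_add_neg]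

theorem form_symmetryₗ_left (x y : K) : B (D.symmetryₗ x) y = B x (D.symmetryₗ y) := by
  rw [form_symmetryₗ]
  conv_lhs => rw [← D.projPos_add_projNeg y]
  simp [symmetryₗ_apply, (D.orthogonal _ (D.projPos_mem x) _ (D.projNeg_mem y)).1,
    (D.orthogonal _ (D.projPos_mem y) _ (D.projNeg_mem x)).2, sub_eq_add_neg]

/-- The inner product `(x, y) ↦ ⟨x, J y⟩ = ⟨x₊, y₊⟩ - ⟨x₋, y₋⟩` on `K`. -/
@[reducible] def core : InnerProductSpace.Core ℂ K where
  inner x y := B x (D.symmetryₗ y)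
  conj_inner_symm x y := by
    obtain ⟨c, hc, -⟩ := D.pos_hilbert
    obtain ⟨d, hd, -⟩ := D.neg_hilbert
    have h1 := c.conj_inner_symm ⟨_, D.projPos_mem x⟩ ⟨_, D.projPos_mem y⟩
    have h2 := d.conj_inner_symm ⟨_, D.projNeg_mem x⟩ ⟨_, D.projNeg_mem y⟩
    simp only [hc, hd, LinearMap.domRestrict₁₂_apply, LinearMap.neg_apply, map_neg] at h1 h2
    rw [form_symmetryₗ, form_symmetryₗ, map_sub, h1, neg_injective h2]
  re_inner_nonneg x := by
    obtain ⟨c, hc, -⟩ := D.pos_hilbert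
    obtain ⟨d, hd, -⟩ := D.neg_hilbert
    have h1 := c.re_inner_nonneg ⟨_, D.projPos_mem x⟩
    have h2 := d.re_inner_nonneg ⟨_, D.projNeg_mem x⟩
    simp only [hc, hd, LinearMap.domRestrict₁₂_apply, LinearMap.neg_apply, map_neg] at h1 h2
    rw [form_symmetryₗ, map_sub]
    linarith
  add_left x y z := by simp
  smul_left x y r := by simp
  definite x hx := by
    obtain ⟨c, hc, -⟩ := D.pos_hilbert
    obtain ⟨d, hd, -⟩ := D.neg_hilbert
    have h1 := c.re_inner_nonneg ⟨_, D.projPos_mem x⟩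
    have h2 := d.re_inner_nonneg ⟨_, D.projNeg_mem x⟩
    have i1 := c.conj_inner_symm ⟨_, D.projPos_mem x⟩ ⟨_, D.projPos_mem x⟩
    have i2 := d.conj_inner_symm ⟨_, D.projNeg_mem x⟩ ⟨_, D.projNeg_mem x⟩
    have k1 := c.definite ⟨_, D.projPos_mem x⟩
    have k2 := d.definite ⟨_, D.projNeg_mem x⟩
    simp only [hc, hd, LinearMap.domRestrict₁₂_apply, LinearMap.neg_apply, map_neg] at h1 h2 i1 i2 k1 k2
    rw [form_symmetryₗ] at hx
    have hr := congrArg RCLike.re hx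
    rw [map_sub, map_zero] at hr
    have j1 : B (D.projPos x) (D.projPos x) = 0 := by
      rw [← RCLike.conj_eq_iff_re.1 i1]
      simp only [Complex.coe_algebraMap, RCLike.re_to_complex, Complex.ofReal_eq_zero] at *
      linarith
    have j2 : B (D.projNeg x) (D.projNeg x) = 0 := by
      rw [j1, zero_sub] at hx
      exact neg_eq_zero.1 hx
    have l1 : D.projPos x = 0 := congrArg Subtype.val (k1 j1)
    have l2 : D.projNeg x = 0 := congrArg Subtype.val (k2 (by rw [j2, neg_zero]))
    rw [← D.projPos_add_projNeg x, l1, l2, add_zero]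

/-- The Hilbert space `|K|_J = K₊ ⊕ (-K₋)` associated with a fundamental decomposition: the vector
space `K` with the inner product `(x, y) ↦ ⟨x, J y⟩`. -/
def HilbertSpace (_ : FundamentalDecomposition B) : Type _ := K

instance : NormedAddCommGroup D.HilbertSpace := D.core.toNormedAddCommGroup

instance : InnerProductSpace ℂ D.HilbertSpace := InnerProductSpace.ofCore D.core.toCore

instance : Inner ℂ D.HilbertSpace := InnerProductSpace.toInner

/-- The identity map from `K` to `|K|_J`. -/
def equiv : K ≃ₗ[ℂ] D.HilbertSpace where
  toFun x := x
  invFun x := x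
  map_add' _ _ := rfl
  map_smul' _ _ := rfl
  left_inv _ := rfl
  right_inv _ := rfl

theorem inner_equiv (x y : K) : inner ℂ (D.equiv x) (D.equiv y) = B x (D.symmetryₗ y) := rfl

theorem norm_equiv_sq (x : K) : ‖D.equiv x‖ ^ 2 =
    (B (D.projPos x) (D.projPos x)).re - (B (D.projNeg x) (D.projNeg x)).re := by
  rw [@norm_sq_eq_re_inner ℂ, inner_equiv, form_symmetryₗ, map_sub]
  rfl

instance : CompleteSpace D.HilbertSpace := by
  obtain ⟨c, hc, hc'⟩ := D.pos_hilbert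
  obtain ⟨d, hd, hd'⟩ := D.neg_hilbert
  let _ : NormedAddCommGroup D.pos := c.toNormedAddCommGroup
  let _ : InnerProductSpace ℂ D.pos := InnerProductSpace.ofCore c.toCore
  let _ : NormedAddCommGroup D.neg := d.toNormedAddCommGroup
  let _ : InnerProductSpace ℂ D.neg := InnerProductSpace.ofCore d.toCore
  have : CompleteSpace D.pos := hc'
  have : CompleteSpace D.neg := hd'
  have np : ∀ x : D.pos, ‖x‖ ^ 2 = (B x x).re := fun x => by
    rw [@norm_sq_eq_re_inner ℂ]; exact congrArg Complex.re (hc x x)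
  have nn : ∀ x : D.neg, ‖x‖ ^ 2 = -(B x x).re := fun x => by
    rw [@norm_sq_eq_re_inner ℂ]; exact congrArg Complex.re (hd x x)
  let e : (D.pos × D.neg) ≃ₗ[ℂ] D.HilbertSpace :=
    (Submodule.prodEquivOfIsCompl D.pos D.neg D.isCompl).trans D.equiv
  have he : ∀ p, ‖e p‖ ^ 2 = ‖p.1‖ ^ 2 + ‖p.2‖ ^ 2 := fun p => by
    have e0 : e p = D.equiv ((p.1 : K) + (p.2 : K)) := rfl
    have e1 : D.projPos ((p.1 : K) + (p.2 : K)) = p.1 := by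
      rw [map_add, D.projPos_of_pos p.1.2, D.projPos_of_neg p.2.2, add_zero]
    have e2 : D.projNeg ((p.1 : K) + (p.2 : K)) = p.2 := by
      rw [map_add, D.projNeg_of_pos p.1.2, D.projNeg_of_neg p.2.2, zero_add]
    rw [e0, norm_equiv_sq, e1, e2, np, nn, sub_eq_add_neg]
  let E : (D.pos × D.neg) ≃L[ℂ] D.HilbertSpace :=
    e.toContinuousLinearEquivOfBounds 2 1
      (fun p => by
        refine abs_le_of_sq_le_sq' ?_ (by positivity) |>.2
        have h1 : ‖p.1‖ ≤ ‖p‖ := norm_fst_le p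
        have h2 : ‖p.2‖ ≤ ‖p‖ := norm_snd_le p
        have h3 := norm_nonneg p.1
        have h4 := norm_nonneg p.2
        rw [he]; nlinarith)
      (fun x => by
        obtain ⟨p, rfl⟩ := e.surjective x
        rw [LinearEquiv.symm_apply_apply, one_mul, Prod.norm_def]
        refine max_le ?_ ?_
        · refine abs_le_of_sq_le_sq' ?_ (norm_nonneg _) |>.2
          rw [he]; nlinarith [sq_nonneg ‖p.2‖]
        · refine abs_le_of_sq_le_sq' ?_ (norm_nonneg _) |>.2
          rw [he]; nlinarith [sq_nonneg ‖p.1‖])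
  exact (completeSpace_congr (e := e.toEquiv) E.isUniformEmbedding).1 inferInstance

/-- The topology on `K` given by the norm of the Hilbert space `|K|_J`. -/
@[reducible] def topology : TopologicalSpace K := inferInstanceAs (TopologicalSpace D.HilbertSpace)

/-- The fundamental symmetry is an isometry of the Hilbert space `|K|_J`. -/
def symmetryHilbert : D.HilbertSpace →L[ℂ] D.HilbertSpace :=
  (D.equiv.toLinearMap ∘ₗ D.symmetryₗ ∘ₗ D.equiv.symm.toLinearMap).mkContinuous 1 fun x => by
    obtain ⟨x, rfl⟩ := D.equiv.surjective x
    refine (abs_le_of_sq_le_sq' ?_ (by positivity)).2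
    rw [LinearMap.comp_apply, LinearMap.comp_apply, LinearEquiv.coe_coe, LinearEquiv.coe_coe,
      LinearEquiv.symm_apply_apply, one_mul, @norm_sq_eq_re_inner ℂ, @norm_sq_eq_re_inner ℂ,
      inner_equiv, inner_equiv, symmetryₗ_symmetryₗ]
    exact (congrArg Complex.re (D.form_symmetryₗ_left x x)).le

theorem symmetryHilbert_equiv (x : K) :
    D.symmetryHilbert (D.equiv x) = D.equiv (D.symmetryₗ x) := rfl

theorem form_eq_inner (x y : K) :
    B x y = inner ℂ (D.equiv x) (D.symmetryHilbert (D.equiv y)) := by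
  rw [symmetryHilbert_equiv, inner_equiv, symmetryₗ_symmetryₗ]

theorem eq_zero_of_form (D : FundamentalDecomposition B) {y : K} (h : ∀ z, B z y = 0) : y = 0 := by
  have := h (D.symmetryₗ y)
  rw [form_symmetryₗ_left] at this
  exact D.core.definite y this

theorem continuous_form (z : K) : Continuous fun v : D.HilbertSpace => B z (D.equiv.symm v) := by
  have : Continuous fun v : D.HilbertSpace => inner ℂ (D.equiv z) (D.symmetryHilbert v) := by
    fun_prop
  refine this.congr fun v => ?_
  rw [form_eq_inner D, LinearEquiv.apply_symm_apply]

/-- The identity map between the Hilbert spaces of two fundamental decompositions is continuous. -/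
theorem continuous_equiv (D' : FundamentalDecomposition B) :
    Continuous (D.equiv.symm.trans D'.equiv) := by
  refine LinearMap.continuous_of_seq_closed_graph
    (g := (D.equiv.symm.trans D'.equiv).toLinearMap) fun u x y hu hy => ?_
  have h1 := fun z => ((D.continuous_form z).tendsto x).comp hu
  have h2 := fun z => ((D'.continuous_form z).tendsto y).comp hy
  have h3 : D'.equiv.symm y - D.equiv.symm x = 0 := D.eq_zero_of_form fun z => by
    rw [map_sub, sub_eq_zero]
    exact tendsto_nhds_unique (h2 z) (h1 z)
  exact (LinearEquiv.symm_apply_eq _).1 (sub_eq_zero.1 h3)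

/-- All fundamental decompositions induce the same topology. -/
theorem topology_eq (D' : FundamentalDecomposition B) : D.topology = D'.topology :=
  le_antisymm (continuous_id_iff_le.1 (D.continuous_equiv D'))
    (continuous_id_iff_le.1 (D'.continuous_equiv D))

end FundamentalDecomposition

/-- A complex Krein space, equipped with its strong topology. The last field says that the form
admits a fundamental decomposition and that the given topology is the one induced by the norm of
the associated Hilbert space; by `FundamentalDecomposition.topology_eq` this topology does not
depend on the decomposition. -/
class KreinSpace (K : Type*) [AddCommGroup K] [Module ℂ K] [t : TopologicalSpace K] where
  form : K →ₗ⋆[ℂ] K →ₗ[ℂ] ℂ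
  form_hermitian : ∀ x y, conj (form x y) = form y x
  exists_decomposition : ∃ D : FundamentalDecomposition form, t = D.topology

namespace KreinSpace

variable {K : Type*} [AddCommGroup K] [Module ℂ K] [t : TopologicalSpace K] [KreinSpace K]

theorem topology_eq (D : FundamentalDecomposition (form (K := K))) : t = D.topology := by
  obtain ⟨D₀, h₀⟩ := exists_decomposition (K := K)
  exact h₀.trans (D₀.topology_eq D)

/-- The identity map of a Krein space, as a homeomorphism onto the Hilbert space `|K|_J`. -/
def toHilbert (D : FundamentalDecomposition (form (K := K))) : K ≃L[ℂ] D.HilbertSpace where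
  toLinearEquiv := D.equiv
  continuous_toFun := continuous_id_iff_le.2 (topology_eq D).le
  continuous_invFun := continuous_id_iff_le.2 (topology_eq D).ge

instance : IsTopologicalAddGroup K := by
  obtain ⟨D, -⟩ := exists_decomposition (K := K)
  exact (toHilbert D).toHomeomorph.isInducing.topologicalAddGroup
    (toHilbert D).toLinearEquiv.toAddEquiv

instance : ContinuousSMul ℂ K := by
  obtain ⟨D, -⟩ := exists_decomposition (K := K)
  exact (toHilbert D).toHomeomorph.isInducing.continuousSMul continuous_id
    (fun {c x} => (toHilbert D).map_smul c x)

/-- The fundamental symmetry of a fundamental decomposition as a continuous operator on `K`. -/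
def symmetry (D : FundamentalDecomposition (form (K := K))) : K →L[ℂ] K :=
  (toHilbert D).symm.toContinuousLinearMap ∘L D.symmetryHilbert ∘L
    (toHilbert D).toContinuousLinearMap

theorem symmetry_apply (D : FundamentalDecomposition (form (K := K))) (x : K) :
    symmetry D x = D.projPos x - D.projNeg x := rfl

theorem ext_form_left {x y : K} (h : ∀ z, form x z = form y z) : x = y := by
  obtain ⟨D, -⟩ := exists_decomposition (K := K)
  rw [← sub_eq_zero]
  refine D.eq_zero_of_form fun z => ?_
  rw [map_sub, sub_eq_zero, ← form_hermitian x z, ← form_hermitian y z, h]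

/-- Every continuous operator on a Krein space has a continuous adjoint for the form. -/
theorem exists_adjoint (T : K →L[ℂ] K) :
    ∃ S : K →L[ℂ] K, ∀ x y, form (S x) y = form x (T y) := by
  obtain ⟨D, -⟩ := exists_decomposition (K := K)
  let e := toHilbert D
  let T' : D.HilbertSpace →L[ℂ] D.HilbertSpace :=
    e.toContinuousLinearMap ∘L T ∘L e.symm.toContinuousLinearMap
  let S' : D.HilbertSpace →L[ℂ] D.HilbertSpace :=
    D.symmetryHilbert ∘L ContinuousLinearMap.adjoint T' ∘L D.symmetryHilbert
  refine ⟨e.symm.toContinuousLinearMap ∘L S' ∘L e.toContinuousLinearMap, fun x y => ?_⟩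
  have h := ContinuousLinearMap.adjoint_inner_left T' (D.equiv y) (D.equiv (D.symmetryₗ x))
  obtain ⟨w, hw⟩ := D.equiv.surjective (ContinuousLinearMap.adjoint T' (D.equiv (D.symmetryₗ x)))
  have hT : T' (D.equiv y) = D.equiv (T y) := rfl
  rw [hT, ← hw, D.inner_equiv, D.inner_equiv, ← D.form_symmetryₗ_left, ← D.form_symmetryₗ_left,
    D.symmetryₗ_symmetryₗ] at h
  have hS : (e.symm.toContinuousLinearMap ∘L S' ∘L e.toContinuousLinearMap) x = D.symmetryₗ w :=
    congrArg (fun v => D.equiv.symm (D.symmetryHilbert v)) hw.symm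
  rw [hS]
  exact h

/-- The involution on the algebra of continuous operators is the Krein space adjoint. -/
instance : Star (K →L[ℂ] K) where
  star T := Classical.choose (exists_adjoint T)

theorem form_star_left (T : K →L[ℂ] K) (x y : K) : form (star T x) y = form x (T y) :=
  Classical.choose_spec (exists_adjoint T) x y

theorem form_star_right (T : K →L[ℂ] K) (x y : K) : form x (star T y) = form (T x) y := by
  rw [← form_hermitian, form_star_left, form_hermitian]

instance : StarRing (K →L[ℂ] K) where
  star_involutive T := by
    ext x
    exact ext_form_left fun z => by rw [form_star_left, form_star_right]
  star_mul S T := by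
    ext x
    exact ext_form_left fun z => by
      simp only [form_star_left, _root_.mul_apply_eq_comp]
  star_add S T := by
    ext x
    exact ext_form_left fun z => by
      simp only [form_star_left, _root_.add_apply, map_add, LinearMap.add_apply]

instance : StarModule ℂ (K →L[ℂ] K) where
  star_smul c T := by
    ext x
    exact ext_form_left fun z => by
      simp [form_star_left]

end KreinSpace

/-! ### Krein C*-algebras -/

/-- The algebra norm `p` is complete. -/
def AlgebraNorm.IsComplete {A : Type*} [Ring A] [Algebra ℂ A] (p : AlgebraNorm ℂ A) : Prop :=
  @CompleteSpace A p.toRingNorm.toNormedRing.toMetricSpace.toUniformSpace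

/-- A fundamental symmetry of a complex `*`-algebra: an involutive `*`-automorphism `α` such that
`‖α(x*)x‖ = ‖x‖²` for some norm making the algebra a Banach algebra. -/
def IsKreinFundamentalSymmetry {A : Type*} [Ring A] [StarRing A] [Algebra ℂ A]
    (α : A ≃⋆ₐ[ℂ] A) : Prop :=
  (∀ x, α (α x) = x) ∧
    ∃ p : AlgebraNorm ℂ A, p.IsComplete ∧ ∀ x, p (α (star x) * x) = p x ^ 2

/-- A unital Krein C*-algebra: a unital complex `*`-algebra that admits a fundamental symmetry. -/
class IsKreinCStarAlgebra (A : Type*) [Ring A] [StarRing A] [Algebra ℂ A] [StarModule ℂ A] :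
    Prop where
  exists_fundamentalSymmetry : ∃ α : A ≃⋆ₐ[ℂ] A, IsKreinFundamentalSymmetry α

end

noncomputable section

/-! ### The Gelfand–Naimark theorem -/

section GelfandNaimark

open scoped ComplexOrder InnerProductSpace

/-! The involution `x ↦ α(x*)`, together with the norm belonging to `α`, makes `A` a C*-algebra, and
`α`, which commutes with `*`, is an involutive *-automorphism `θ` of it. By Gelfand–Naimark this
C*-algebra has a faithful representation `ρ` on a Hilbert space `H`. Nothing forces `θ` to be
implemented on `H`, so the representation is doubled: on `H ⊕ H` take `σ = ρ ⊕ (ρ ∘ θ)` and let `J`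
exchange the summands, so that `σ(θ a) = J σ(a) J`.

Since `a*` is the twisted adjoint of `θ a`, the operator `σ(a*)` is the Hilbert adjoint of `J σ(a)
J`, which is exactly the adjoint of `σ(a)` for the form `⟪x, J y⟫`. Hence `σ` is a *-representation
on the Krein space given by `J`. Its range is closed because an injective *-homomorphism of
C*-algebras is isometric.

Gelfand–Naimark itself is the direct sum of the GNS representations of all positive functionals;
`CStarAlgebra.exists_positive_functional_ne_zero` supplies enough of them by separating a point from
the positive cone. -/

/-- A nonzero element of a C*-algebra is detected by a positive functional. -/
theorem CStarAlgebra.exists_positive_functional_ne_zero {A : Type*} [CStarAlgebra A]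
    [PartialOrder A] [StarOrderedRing A] {a : A} (ha : a ≠ 0) :
    ∃ f : A →ₚ[ℂ] ℂ, f (star a * a) ≠ 0 := by
  have hneg : -(star a * a) ∉ ProperCone.positive ℝ A := fun h => by
    rw [ProperCone.mem_positive, neg_nonneg] at h
    exact ha ((CStarRing.star_mul_self_eq_zero_iff a).1 (h.antisymm (star_mul_self_nonneg a)))
  obtain ⟨g, hg, hga⟩ := ProperCone.hyperplane_separation_point _ hneg
  -- Symmetrizing `g` makes `h (i x) = 0` for self-adjoint `x`, so the complex extension of `h`
  -- takes the real value `2 g x` there.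
  let h : StrongDual ℝ A := g + g ∘L (starL' ℝ : A ≃L[ℝ] A).toContinuousLinearMap
  have h_apply : ∀ x, h x = g x + g (star x) := fun x => rfl
  have h_extend : ∀ x : A, IsSelfAdjoint x → h.extendRCLike (𝕜 := ℂ) x = ((2 * g x : ℝ) : ℂ) := by
    intro x hx
    rw [StrongDual.extendRCLike_apply, h_apply, h_apply, star_smul, hx.star_eq]
    simp [two_mul]
  refine ⟨.mk₀ (h.extendRCLike (𝕜 := ℂ)).toLinearMap fun x hx => ?_, ?_⟩
  · have := h_extend x (.of_nonneg hx)
    have hgx : 0 ≤ g x := hg x hx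
    refine this.symm ▸ ?_
    exact_mod_cast (by positivity : 0 ≤ 2 * g x)
  · have := h_extend _ (IsSelfAdjoint.star_mul_self a)
    have hgx : 0 < g (star a * a) := by simpa using hga
    refine fun h0 => ?_
    have := this.symm.trans h0
    norm_cast at this
    linarith

section DirectSum

variable {ι : Type*} {H : ι → Type*} [∀ i, NormedAddCommGroup (H i)]
  [∀ i, InnerProductSpace ℂ (H i)]

/-- The direct sum of a family of representations of a C*-algebra. -/
def StarAlgHom.directSum {A : Type*} [CStarAlgebra A] [∀ i, CompleteSpace (H i)]
    (ρ : ∀ i, A →⋆ₐ[ℂ] (H i →L[ℂ] H i)) : A →⋆ₐ[ℂ] (lp H 2 →L[ℂ] lp H 2) where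
  -- *-homomorphisms are contractive, so `‖a‖` bounds all summands at once.
  toFun a := lp.mapCLM 2 (fun i => ρ i a) (norm_nonneg a) fun i =>
    NonUnitalStarAlgHom.norm_apply_le (ρ i) a
  map_one' := by ext x i; simp
  map_mul' a b := by ext x i; simp
  map_zero' := by ext x i; simp
  map_add' a b := by ext x i; simp
  commutes' r := by ext x i; simp [Algebra.algebraMap_eq_smul_one]
  map_star' a := by
    refine (ContinuousLinearMap.eq_adjoint_iff _ _).2 fun x y => ?_
    rw [lp.inner_eq_tsum, lp.inner_eq_tsum]
    congr! 2 with i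
    rw [lp.mapCLM_apply_coe, lp.mapCLM_apply_coe, map_star, ContinuousLinearMap.star_eq_adjoint,
      ContinuousLinearMap.adjoint_inner_left]

theorem StarAlgHom.directSum_apply {A : Type*} [CStarAlgebra A] [∀ i, CompleteSpace (H i)]
    (ρ : ∀ i, A →⋆ₐ[ℂ] (H i →L[ℂ] H i)) (a : A) (x : lp H 2) (i : ι) :
    StarAlgHom.directSum ρ a x i = ρ i a (x i) := rfl

theorem StarAlgHom.eq_zero_of_directSum {A : Type*} [CStarAlgebra A] [∀ i, CompleteSpace (H i)]
    {ρ : ∀ i, A →⋆ₐ[ℂ] (H i →L[ℂ] H i)} {a : A} (h : StarAlgHom.directSum ρ a = 0) (i : ι) :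
    ρ i a = 0 := by
  classical
  ext v
  have := congrArg (fun T => (T (lp.single 2 i v) : ∀ i, H i) i) h
  simpa [StarAlgHom.directSum_apply] using this

end DirectSum

/-- The Gelfand–Naimark theorem. -/
theorem CStarAlgebra.exists_faithful_representation (A : Type u) [CStarAlgebra A] :
    ∃ (H : Type u) (_ : NormedAddCommGroup H) (_ : InnerProductSpace ℂ H) (_ : CompleteSpace H)
      (ρ : A →⋆ₐ[ℂ] (H →L[ℂ] H)), Function.Injective ρ := by
  let _ : PartialOrder A := CStarAlgebra.spectralOrder A
  have _ : StarOrderedRing A := CStarAlgebra.spectralOrderedRing A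
  refine ⟨lp (fun f : A →ₚ[ℂ] ℂ => f.GNS) 2, inferInstance, inferInstance, inferInstance,
    StarAlgHom.directSum fun f => f.gnsStarAlgHom, ?_⟩
  refine (injective_iff_map_eq_zero _).2 fun a ha => ?_
  by_contra hne
  obtain ⟨f, hf⟩ := CStarAlgebra.exists_positive_functional_ne_zero hne
  -- The GNS operator of `a` sends the class of `1` to the class of `a`, whose squared norm is `f
  -- (star a * a)`.
  have h0 := congrArg (fun T => T (f.toPreGNS 1 : f.GNS)) (StarAlgHom.eq_zero_of_directSum ha f)
  have h1 : ((f.toPreGNS a : f.PreGNS) : f.GNS) = 0 := by simpa using h0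
  have h2 : ‖f.toPreGNS a‖ = 0 := by rw [← UniformSpace.Completion.norm_coe, h1, norm_zero]
  have h3 := f.preGNS_norm_sq (f.toPreGNS a)
  rw [h2] at h3
  exact hf (by simpa using h3.symm)

end GelfandNaimark

/-! ### Krein spaces from symmetric involutions of Hilbert spaces -/

section KreinOfSymmetry

open scoped InnerProductSpace

/-- An inner product core whose inner product is the given one induces the given uniformity. -/
theorem InnerProductSpace.Core.uniformSpace_eq {V : Type*} [n : NormedAddCommGroup V]
    [i : InnerProductSpace ℂ V] (c : InnerProductSpace.Core ℂ V)
    (hc : ∀ x y : V, c.inner x y = i.inner x y) :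
    c.toNormedAddCommGroup.toMetricSpace.toUniformSpace =
      n.toMetricSpace.toUniformSpace := by
  have hnorm : ∀ x : V, @norm V c.toNormedAddCommGroup.toNorm x = ‖x‖ := fun x => by
    refine Eq.trans ?_ (_root_.norm_eq_sqrt_re_inner (𝕜 := ℂ) x).symm
    exact congrArg (fun z => √(RCLike.re z)) (hc x x)
  refine congrArg (@PseudoMetricSpace.toUniformSpace V) (PseudoMetricSpace.ext (Dist.ext ?_))
  funext x y
  rw [@NormedAddCommGroup.dist_eq V c.toNormedAddCommGroup, @NormedAddCommGroup.dist_eq V n]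
  exact hnorm _

/-- A complete inner product space satisfies `IsHilbertForm` for every form that agrees with its
inner product. -/
theorem isHilbertForm_of_inner {V : Type*} [n : NormedAddCommGroup V] [i : InnerProductSpace ℂ V]
    [hV : CompleteSpace V] {B : V →ₗ⋆[ℂ] V →ₗ[ℂ] ℂ} (hB : ∀ x y, B x y = ⟪x, y⟫_ℂ) :
    IsHilbertForm B := by
  let c : InnerProductSpace.Core ℂ V :=
    { inner := fun x y => ⟪x, y⟫_ℂ
      conj_inner_symm := inner_conj_symm
      re_inner_nonneg := fun _ => inner_self_nonneg
      add_left := inner_add_left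
      smul_left := inner_smul_left
      definite := fun _ => inner_self_eq_zero.1 }
  refine ⟨c, fun x y => (hB x y).symm, ?_⟩
  rw [c.uniformSpace_eq fun _ _ => rfl]
  exact hV

/-- A Hilbert space `H` with a symmetric involution `J`, regarded as a Krein space. -/
def KreinOf {H : Type*} [NormedAddCommGroup H] [InnerProductSpace ℂ H] (_ : H →ₗ[ℂ] H) : Type _ := H

namespace KreinOf

variable {H : Type*} [n : NormedAddCommGroup H] [InnerProductSpace ℂ H]

/-- Only the vector space and its topology are carried over: with the inner product hidden, the star
on operators is the Krein adjoint and not the Hilbert adjoint. -/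
instance (J : H →ₗ[ℂ] H) : AddCommGroup (KreinOf J) := inferInstanceAs (AddCommGroup H)
instance (J : H →ₗ[ℂ] H) : Module ℂ (KreinOf J) := inferInstanceAs (Module ℂ H)
instance (J : H →ₗ[ℂ] H) : TopologicalSpace (KreinOf J) := inferInstanceAs (TopologicalSpace H)

/-- The indefinite form `(x, y) ↦ ⟪x, J y⟫`. -/
def form (J : H →ₗ[ℂ] H) : H →ₗ⋆[ℂ] H →ₗ[ℂ] ℂ :=
  (innerₛₗ ℂ (E := H)).compl₂ J

theorem form_apply (J : H →ₗ[ℂ] H) (x y : H) : form J x y = ⟪x, J y⟫_ℂ := rfl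

theorem form_hermitian {J : H →ₗ[ℂ] H} (hJ : J.IsSymmetric) (x y : H) : conj (form J x y) = form J y x := by
  rw [form_apply, form_apply, inner_conj_symm, hJ]

variable {J : H →ₗ[ℂ] H} [CompleteSpace H]

/-- The decomposition of `H` into the eigenspaces of a symmetric involution. -/
def decomposition (hJ : J.IsSymmetric) (hJ2 : ∀ x, J (J x) = x) :
    FundamentalDecomposition (form J) where
  pos := LinearMap.eqLocus J LinearMap.id
  neg := LinearMap.eqLocus J (-LinearMap.id)
  isCompl := by
    refine IsCompl.of_eq ((Submodule.eq_bot_iff _).2 fun x hx => ?_)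
      (Submodule.eq_top_iff'.2 fun x => ?_)
    · obtain ⟨h1, h2⟩ := hx
      have h1 : J x = x := h1
      have h2 : J x = -x := h2
      have h3 : (2 : ℂ) • x = 0 := by
        rw [two_smul]
        exact eq_neg_iff_add_eq_zero.1 (h1.symm.trans h2)
      exact (smul_eq_zero.1 h3).resolve_left two_ne_zero
    · refine Submodule.mem_sup.2
        ⟨(2⁻¹ : ℂ) • (x + J x), ?_, (2⁻¹ : ℂ) • (x - J x), ?_, by module⟩
      · change J _ = _
        rw [map_smul, map_add, hJ2, add_comm]
        rfl
      · change J _ = -((2⁻¹ : ℂ) • (x - J x))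
        rw [map_smul, map_sub, hJ2, ← smul_neg, neg_sub]
  orthogonal x hx y hy := by
    have hx : J x = x := hx
    have hy : J y = -y := hy
    -- Symmetry of `J` gives `⟪x, y⟫ = ⟪J x, y⟫ = ⟪x, J y⟫ = -⟪x, y⟫`.
    have h : ⟪x, y⟫_ℂ = 0 := by
      have := hJ x y
      rw [hx, hy, inner_neg_right] at this
      exact self_eq_neg.1 this
    constructor
    · rw [form_apply, hy, inner_neg_right, h, neg_zero]
    · rw [form_apply, hx, ← inner_conj_symm, h, map_zero]
  pos_hilbert := by
    -- An everywhere defined symmetric operator is continuous (Hellinger–Toeplitz), so its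
    -- eigenspaces are closed and therefore complete.
    have hP : IsClosed (LinearMap.eqLocus J LinearMap.id : Set H) :=
      isClosed_eq hJ.continuous continuous_id
    have := hP.completeSpace_coe
    refine isHilbertForm_of_inner fun x y => ?_
    have hy : J y = y := y.2
    rw [LinearMap.domRestrict₁₂_apply, form_apply, hy]
    rfl
  neg_hilbert := by
    have hN : IsClosed (LinearMap.eqLocus J (-LinearMap.id) : Set H) :=
      isClosed_eq hJ.continuous continuous_neg
    have := hN.completeSpace_coe
    refine isHilbertForm_of_inner fun x y => ?_
    have hy : J y = -y := y.2
    rw [LinearMap.domRestrict₁₂_apply, LinearMap.neg_apply, LinearMap.neg_apply, form_apply, hy,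
      inner_neg_right, neg_neg]
    rfl

theorem decomposition_symmetryₗ (hJ : J.IsSymmetric) (hJ2 : ∀ x, J (J x) = x) (x : H) :
    (decomposition hJ hJ2).symmetryₗ x = J x := by
  let D := decomposition hJ hJ2
  have h1 : J (D.projPos x) = D.projPos x := D.projPos_mem x
  have h2 : J (D.projNeg x) = -D.projNeg x := D.projNeg_mem x
  have h3 : D.symmetryₗ x = D.projPos x - D.projNeg x := D.symmetryₗ_apply x
  conv_rhs => rw [← D.projPos_add_projNeg x]
  refine h3.trans (Eq.symm ((J.map_add _ _).trans ?_))
  rw [h1, h2]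
  exact (sub_eq_add_neg (G := H) _ _).symm

/-- The Hilbert inner product of the decomposition is `⟪x, J (J y)⟫`, which is the original one
because `J` is an involution. -/
theorem topology_eq (hJ : J.IsSymmetric) (hJ2 : ∀ x, J (J x) = x) :
    (inferInstance : TopologicalSpace H) = (decomposition hJ hJ2).topology :=
  congrArg (@UniformSpace.toTopologicalSpace H)
    (InnerProductSpace.Core.uniformSpace_eq (V := H) (decomposition hJ hJ2).core fun x y => by
      refine (form_apply J x _).trans ?_
      rw [decomposition_symmetryₗ, hJ2]).symm

/-- The Krein space structure given by a symmetric involution of a Hilbert space. -/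
@[reducible] def kreinSpace (hJ : J.IsSymmetric) (hJ2 : ∀ x, J (J x) = x) :
    KreinSpace (KreinOf J) where
  form := form (H := H) J
  form_hermitian := form_hermitian (H := H) hJ
  exists_decomposition := ⟨decomposition (H := H) hJ hJ2, topology_eq (H := H) hJ hJ2⟩

end KreinOf

end KreinOfSymmetry

/-! ### The C*-algebra attached to a fundamental symmetry -/

section Twist

/-- The algebra `A` with the involution `x ↦ α(x*)`. -/
def TwistedStar {A : Type u} [Ring A] [StarRing A] [Algebra ℂ A] (_ : A ≃⋆ₐ[ℂ] A) : Type u := A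

namespace TwistedStar

variable {A : Type u} [Ring A] [StarRing A] [Algebra ℂ A] {α : A ≃⋆ₐ[ℂ] A}

/-- The C*-algebra structure given by a fundamental symmetry. -/
@[reducible] def cstarAlgebra [StarModule ℂ A] (h2 : ∀ x, α (α x) = x) (p : AlgebraNorm ℂ A)
    (hp : p.IsComplete) (hpα : ∀ x, p (α (star x) * x) = p x ^ 2) :
    CStarAlgebra (TwistedStar α) where
  __ : NormedRing A := p.toRingNorm.toNormedRing
  __ : Algebra ℂ A := inferInstance
  norm_smul_le c x := (p.toSeminorm.smul' c x).le
  star x := α (star (show A from x))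
  star_involutive x := by
    change α (star (α (star _))) = _
    rw [← map_star, star_star, h2]
  star_mul x y := by
    change α (star ((show A from x) * (show A from y))) = _
    rw [star_mul, map_mul]
    rfl
  star_add x y := by
    change α (star ((show A from x) + (show A from y))) = _
    rw [star_add, map_add]
    rfl
  star_smul c x := by
    change α (star (c • (show A from x))) = _
    rw [star_smul, map_smul]
    rfl
  complete := hp.complete
  -- For the twisted star, the condition on `α` is literally the C*-identity.
  norm_mul_self_le x := ((sq _).symm.trans (hpα x).symm).le

/-- A fundamental symmetry as an automorphism of the twisted `*`-algebra. -/
@[reducible] def symmetryHom [StarModule ℂ A] (h2 : ∀ x, α (α x) = x) (p : AlgebraNorm ℂ A)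
    (hp : p.IsComplete) (hpα : ∀ x, p (α (star x) * x) = p x ^ 2) :
    letI := cstarAlgebra h2 p hp hpα
    TwistedStar α →⋆ₐ[ℂ] TwistedStar α :=
  letI := cstarAlgebra h2 p hp hpα
  { toFun := α
    map_one' := map_one α
    map_mul' := map_mul α
    map_zero' := map_zero α
    map_add' := map_add α
    commutes' := fun r => AlgHomClass.commutes α r
    map_star' := fun x => congrArg α (map_star α (show A from x)) }

end TwistedStar

end Twist

/-! ### Doubling the representation -/

section KreinRepresentation

open scoped InnerProductSpace

namespace KreinOf

variable {A : Type*} [Ring A] [StarRing A] [Algebra ℂ A] {H : Type*} [NormedAddCommGroup H]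
  [InnerProductSpace ℂ H] [CompleteSpace H] {J : H →ₗ[ℂ] H}

/-- The Krein adjoint is obtained by choice, so it has to be recognized by its defining identity;
nondegeneracy of the form makes it unique. -/
theorem eq_star (hJ : J.IsSymmetric) (hJ2 : ∀ x, J (J x) = x) (S T : KreinOf J →L[ℂ] KreinOf J)
    (h : ∀ x y : H, form J (S x) y = form J x (T y)) :
    letI := kreinSpace hJ hJ2
    S = star T := by
  let _ := kreinSpace hJ hJ2
  refine ContinuousLinearMap.ext fun x => KreinSpace.ext_form_left fun y => ?_
  rw [KreinSpace.form_star_left]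
  exact h x y

/-- A representation on `H` that is compatible with the indefinite form is a `*`-representation on
the Krein space. -/
@[reducible] def starAlgHom (hJ : J.IsSymmetric) (hJ2 : ∀ x, J (J x) = x)
    (ρ : A →ₐ[ℂ] (H →L[ℂ] H)) (hρ : ∀ a x y, ⟪ρ (star a) x, J y⟫_ℂ = ⟪x, J (ρ a y)⟫_ℂ) :
    letI := kreinSpace hJ hJ2
    A →⋆ₐ[ℂ] (KreinOf J →L[ℂ] KreinOf J) :=
  letI := kreinSpace hJ hJ2
  { toFun := ρ
    map_one' := map_one ρ
    map_mul' := map_mul ρ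
    map_zero' := map_zero ρ
    map_add' := map_add ρ
    commutes' := fun r => AlgHomClass.commutes ρ r
    map_star' := fun a => eq_star hJ hJ2 (ρ (star a)) (ρ a) (hρ a) }

end KreinOf

/-- A representation on a Hilbert space that is compatible with a symmetric involution yields a
representation on a Krein space that implements a fundamental symmetry. -/
theorem exists_krein_representation {A : Type u} [Ring A] [StarRing A] [Algebra ℂ A]
    (α : A ≃⋆ₐ[ℂ] A) {H : Type u} [NormedAddCommGroup H] [InnerProductSpace ℂ H]
    [CompleteSpace H] {J : H →ₗ[ℂ] H} (hJ : J.IsSymmetric) (hJ2 : ∀ x, J (J x) = x)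
    (ρ : A →ₐ[ℂ] (H →L[ℂ] H)) (hρ : ∀ a x y, ⟪ρ (star a) x, J y⟫_ℂ = ⟪x, J (ρ a y)⟫_ℂ)
    (hinj : Function.Injective ρ) (hclosed : IsClosed (Set.range ρ))
    (hα : ∀ a x, ρ (α a) x = J (ρ a (J x))) :
    ∃ (K : Type u) (_ : AddCommGroup K) (_ : Module ℂ K) (_ : TopologicalSpace K)
      (_ : KreinSpace K) (D : FundamentalDecomposition (KreinSpace.form (K := K)))
      (π : A →⋆ₐ[ℂ] (K →L[ℂ] K)) (S : StarSubalgebra ℂ (K →L[ℂ] K)) (e : A ≃⋆ₐ[ℂ] S),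
      Function.Injective π ∧
      IsClosed (S : Set (K →L[ℂ] K)) ∧
      (∀ x, (e x : K →L[ℂ] K) = π x) ∧
      ∀ x, π (α x) = KreinSpace.symmetry D * π x * KreinSpace.symmetry D := by
  let _ := KreinOf.kreinSpace hJ hJ2
  let π := KreinOf.starAlgHom hJ hJ2 ρ hρ
  have hπ : Function.Injective π := hinj
  let D : FundamentalDecomposition (KreinSpace.form (K := KreinOf J)) :=
    KreinOf.decomposition (H := H) hJ hJ2
  have hD : ∀ v : H, KreinSpace.symmetry D v = J v := KreinOf.decomposition_symmetryₗ hJ hJ2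
  -- `KreinOf J` has the topology of `H` by definition, so the operator algebras have the same
  -- topology and `hclosed` applies unchanged.
  refine ⟨KreinOf J, inferInstance, inferInstance, inferInstance, KreinOf.kreinSpace hJ hJ2,
    D, π, π.range, StarAlgEquiv.ofInjective π hπ, hπ, hclosed, fun _ => rfl,
    fun a => ContinuousLinearMap.ext fun x : H => ?_⟩
  change ρ (α a) x = KreinSpace.symmetry D (ρ a (KreinSpace.symmetry D x))
  rw [hα, ← hD x]
  exact (hD _).symm

/-- The exchange of the summands of `H ⊕ H`. -/
def lp.boolSwap (H : Type*) [NormedAddCommGroup H] [InnerProductSpace ℂ H] :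
    lp (fun _ : Bool => H) 2 →ₗ[ℂ] lp (fun _ : Bool => H) 2 where
  toFun x := ⟨fun b => x (!b), Memℓp.all _⟩
  map_add' _ _ := rfl
  map_smul' _ _ := rfl

theorem lp.boolSwap_apply {H : Type*} [NormedAddCommGroup H] [InnerProductSpace ℂ H]
    (x : lp (fun _ : Bool => H) 2) (b : Bool) : lp.boolSwap H x b = x (!b) := rfl

theorem lp.boolSwap_boolSwap {H : Type*} [NormedAddCommGroup H] [InnerProductSpace ℂ H]
    (x : lp (fun _ : Bool => H) 2) : lp.boolSwap H (lp.boolSwap H x) = x :=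
  lp.ext (funext fun b => by rw [lp.boolSwap_apply, lp.boolSwap_apply, Bool.not_not])

theorem lp.boolSwap_isSymmetric (H : Type*) [NormedAddCommGroup H] [InnerProductSpace ℂ H] :
    (lp.boolSwap H).IsSymmetric := fun x y => by
  simp [lp.inner_eq_tsum, lp.boolSwap_apply, tsum_fintype, add_comm]

theorem IsKreinFundamentalSymmetry.exists_representation {A : Type u} [Ring A] [StarRing A]
    [Algebra ℂ A] [StarModule ℂ A] {α : A ≃⋆ₐ[ℂ] A} (hα : IsKreinFundamentalSymmetry α) :
    ∃ (K : Type u) (_ : AddCommGroup K) (_ : Module ℂ K) (_ : TopologicalSpace K)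
      (_ : KreinSpace K) (D : FundamentalDecomposition (KreinSpace.form (K := K)))
      (π : A →⋆ₐ[ℂ] (K →L[ℂ] K)) (S : StarSubalgebra ℂ (K →L[ℂ] K)) (e : A ≃⋆ₐ[ℂ] S),
      Function.Injective π ∧
      IsClosed (S : Set (K →L[ℂ] K)) ∧
      (∀ x, (e x : K →L[ℂ] K) = π x) ∧
      ∀ x, π (α x) = KreinSpace.symmetry D * π x * KreinSpace.symmetry D := by
  obtain ⟨h2, p, hp, hpα⟩ := hα
  let _ : CStarAlgebra (TwistedStar α) := TwistedStar.cstarAlgebra h2 p hp hpα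
  let θ := TwistedStar.symmetryHom h2 p hp hpα
  have hθ : ∀ x, θ (θ x) = x := h2
  obtain ⟨H, _, _, _, ρ, hρ⟩ := CStarAlgebra.exists_faithful_representation (TwistedStar α)
  let σ := StarAlgHom.directSum (H := fun _ : Bool => H) fun b => bif b then ρ else ρ.comp θ
  have hinj : Function.Injective σ := (injective_iff_map_eq_zero σ).2 fun a ha =>
    (injective_iff_map_eq_zero ρ).1 hρ a (StarAlgHom.eq_zero_of_directSum ha true)
  have hswap : ∀ a x, σ (θ a) x = lp.boolSwap H (σ a (lp.boolSwap H x)) := fun a x =>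
    lp.ext (funext fun b => by
      rw [lp.boolSwap_apply, StarAlgHom.directSum_apply, StarAlgHom.directSum_apply,
        lp.boolSwap_apply, Bool.not_not]
      cases b
      -- On the summand carrying `ρ ∘ θ`, the involutivity of `θ` is needed.
      · exact congrArg (fun a => ρ a (x false)) (hθ a)
      · rfl)
  -- The same map as `σ`, but on `A` with its own involution, for which it is only an algebra
  -- homomorphism into the Hilbert space operators.
  let τ : A →ₐ[ℂ] (lp (fun _ : Bool => H) 2 →L[ℂ] lp (fun _ : Bool => H) 2) :=
    { toFun := σ
      map_one' := map_one σ
      map_mul' := map_mul σ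
      map_zero' := map_zero σ
      map_add' := map_add σ
      commutes' := fun r => AlgHomClass.commutes σ r }
  refine exists_krein_representation α (lp.boolSwap_isSymmetric H) lp.boolSwap_boolSwap τ
    (fun a x y => ?_) hinj
    (NonUnitalStarAlgHom.isometry σ hinj).isClosedEmbedding.isClosed_range hswap
  -- The twisted star of `θ a` is `α(α(a)*) = α(α(a*)) = a*`.
  have hstar : τ (star a) = ContinuousLinearMap.adjoint (σ (θ a)) := by
    rw [← ContinuousLinearMap.star_eq_adjoint, ← map_star]
    change σ _ = σ (α (star (α a)))
    rw [← map_star, h2]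
  rw [hstar, ContinuousLinearMap.adjoint_inner_left]
  refine congrArg (fun z => ⟪x, z⟫_ℂ) ((hswap a _).trans ?_)
  rw [lp.boolSwap_boolSwap]
  rfl

end KreinRepresentation

end

theorem mainTheorem1 {A : Type u} [Ring A] [StarRing A] [Algebra ℂ A] [StarModule ℂ A]
    [IsKreinCStarAlgebra A] :
    (∃ (K : Type u) (_ : AddCommGroup K) (_ : Module ℂ K) (_ : TopologicalSpace K)
      (_ : KreinSpace K) (π : A →⋆ₐ[ℂ] (K →L[ℂ] K)), Function.Injective π) ∧
    ∀ α : A ≃⋆ₐ[ℂ] A, IsKreinFundamentalSymmetry α →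
      ∃ (K : Type u) (_ : AddCommGroup K) (_ : Module ℂ K) (_ : TopologicalSpace K)
        (_ : KreinSpace K) (D : FundamentalDecomposition (KreinSpace.form (K := K)))
        (π : A →⋆ₐ[ℂ] (K →L[ℂ] K)) (S : StarSubalgebra ℂ (K →L[ℂ] K)) (e : A ≃⋆ₐ[ℂ] S),
        Function.Injective π ∧
        IsClosed (S : Set (K →L[ℂ] K)) ∧
        (∀ x, (e x : K →L[ℂ] K) = π x) ∧
        ∀ x, π (α x) = KreinSpace.symmetry D * π x * KreinSpace.symmetry D := by
  refine ⟨?_, fun α hα => hα.exists_representation⟩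
  obtain ⟨α, hα⟩ := IsKreinCStarAlgebra.exists_fundamentalSymmetry (A := A)
  obtain ⟨K, h1, h2, h3, h4, -, π, -, -, hπ, -⟩ := hα.exists_representation
  exact ⟨K, h1, h2, h3, h4, π, hπ⟩
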